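/- A quarter plane loop of half-length $n$ is a word $w$ of length $2n$ in the steps $\mathsf E=(1,0)$, $\mathsf N=(0,1)$, $\mathsf W=(-1,0)$, $\mathsf S=(0,-1)$ such that the lattice walk starting at the origin with steps $w$ stays in $\{(x,y): x\ge 0,\ y\ge 0\}$ and ends at the origin. A corner of $w$ is a pair of consecutive steps equal to $\mathsf{NW}$ or $\mathsf{ES}$. Let $$Q(a,u)=\sum_{n\ge 0} u^n\sum_{w} a^{\mathrm{corners}(w)}\in\mathbb N[a][[u]],$$ where the inner sum runs over quarter plane loops $w$ of half-length $n$. For fixed real $a$, let $\rho_Q(a)\in[0,\infty]$ be the radius of convergence of the power series $Q(a,\cdot)$ in $u$. Then: 1. $\rho_Q(-1)=\frac18$ and $\rho_Q(1)=\frac1{16}$. 2. $\rho_Q$ is finite and non-increasing on $[0,+\infty)$, and continuous on $(0,+\infty)$. 3. For all $a\ge 0$, $\displaystyle \rho_Q(a)\ge \frac{1}{(2+\sqrt{2+2a})^2}$. 4. For $a=-1$ and for $a=1$, the series $\frac{\partial Q}{\partial u}(a,u)$ converges at $u=\rho_Q(a)$. 5. If $Q$ is $(a+1)$-positive, that is,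 if there are polynomials $P_n\in\mathbb N[x]$ such that $Q(a,u)=\sum_{n\ge 0}P_n(a+1)\,u^n$, then $\rho_Q$ is non-increasing on $[-1,+\infty)$ and continuous on $(-1,+\infty)$. -/

import Mathlib

open scoped ENNReal

/-- The four unit steps `(1,0)`, `(0,1)`, `(-1,0)`, `(0,-1)` of the square lattice. -/
inductive LatticeStep : Type where
  | E : LatticeStep
  | N : LatticeStep
  | W : LatticeStep
  | S : LatticeStep

namespace LatticeStep

instance instDecidableEq : DecidableEq LatticeStep := fun a b => by
  cases a <;> cases b <;> first | exact isTrue rfl | exact isFalse (fun h => nomatch h)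

instance instFintype : Fintype LatticeStep where
  elems := {E, N, W, S}
  complete := fun a => by cases a <;> decide

/-- The displacement of a step. -/
def vec : LatticeStep → ℤ × ℤ
  | E => (1, 0)
  | N => (0, 1)
  | W => (-1, 0)
  | S => (0, -1)

end LatticeStep

/-- The endpoint of the square lattice walk that starts at the origin and has the given steps. -/
def walkEnd (w : List LatticeStep) : ℤ × ℤ := (w.map LatticeStep.vec).sum

/-- The walk stays in the quadrant `{(x, y) : 0 ≤ x, 0 ≤ y}`:
the endpoint of each of its prefixes lies there. -/
def IsQuarterPlaneWalk (w : List LatticeStep) : Prop :=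
  ∀ p ∈ w.inits, 0 ≤ (walkEnd p).1 ∧ 0 ≤ (walkEnd p).2

/-- A quarter plane walk that returns to the origin. -/
def IsQuarterPlaneLoop (w : List LatticeStep) : Prop :=
  IsQuarterPlaneWalk w ∧ walkEnd w = 0

instance instDecidablePredIsQuarterPlaneLoop : DecidablePred IsQuarterPlaneLoop := fun w => by
  unfold IsQuarterPlaneLoop IsQuarterPlaneWalk
  infer_instance

/-- The number of corners, that is, of pairs of consecutive steps of the form `NW` or `ES`. -/
def cornerCount (w : List LatticeStep) : ℕ :=
  (w.zip w.tail).countP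
    (fun p => p = (LatticeStep.N, LatticeStep.W) ∨ p = (LatticeStep.E, LatticeStep.S))

/-- The quarter plane loops of half-length `n`, that is, with `2 * n` steps. -/
def quarterPlaneLoops (n : ℕ) : Finset (List.Vector LatticeStep (2 * n)) :=
  Finset.univ.filter (fun w => IsQuarterPlaneLoop w.toList)

/-- The series `Q(a,u) ∈ ℕ[a][[u]]` counting quarter plane loops by half-length (`u`) and
corners (`a`). -/
noncomputable def seriesQ : PowerSeries (Polynomial ℕ) :=
  PowerSeries.mk fun n =>
    ∑ w ∈ quarterPlaneLoops n, (Polynomial.X : Polynomial ℕ) ^ cornerCount w.toList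

/-- The power series `Q(a, ·)` in `u`, for a fixed real number `a`. -/
noncomputable def seriesQAt (a : ℝ) : PowerSeries ℝ :=
  PowerSeries.map (Polynomial.eval₂RingHom (Nat.castRingHom ℝ) a) seriesQ

/-- The radius of convergence of a real power series in one variable. -/
noncomputable def convergenceRadius (F : PowerSeries ℝ) : ℝ≥0∞ :=
  (FormalMultilinearSeries.ofScalars ℝ (fun n => PowerSeries.coeff n F)).radius

/-- `ρ_Q(a)`, the radius of convergence of `Q(a, ·)`. -/
noncomputable def rhoQ (a : ℝ) : ℝ≥0∞ := convergenceRadius (seriesQAt a)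

/-- Convergence of a real power series at the point `r`. -/
def ConvergesAt (F : PowerSeries ℝ) (r : ℝ) : Prop :=
  Summable fun n => PowerSeries.coeff n F * r ^ n

/-- A series `F(a,u) ∈ ℕ[a][[u]]` is `(a+1)`-positive if `F(a,u) = ∑ P_n(a+1) u^n` for some
polynomials `P_n` with coefficients in `ℕ`; the identity is one between polynomials in `a`
over `ℤ`. -/
def IsAddOnePositive (F : PowerSeries (Polynomial ℕ)) : Prop :=
  ∃ P : ℕ → Polynomial ℕ, ∀ n : ℕ,
    (PowerSeries.coeff n F).map (Nat.castRingHom ℤ) =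
      ((P n).map (Nat.castRingHom ℤ)).comp (Polynomial.X + 1)

/-! A quarter plane loop is a shuffle of two Dyck words, its horizontal and vertical projections. So
the coefficient of `u ^ n` is a sum, over pairs of Dyck words of semilengths `i + j = n`, of the
corner-weighted count `shuffleSum a α β`. Reading the first step gives the recursion
`shuffleSum_cons_cons`: Pascal's rule plus a correction `(a - 1) * shuffleSum a α β` when the first
letters differ.

At `a = 1` the correction vanishes and the count is a binomial coefficient. At `a = -1` the
recursion is solved by a coefficient of a product of linear factors, which for Dyck words collapses
to `(i + j).choose i`. The coefficients are therefore the sums over `i + j = n` of `(2 * n).choose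
(2 * i)`, respectively `n.choose i`, times `catalan i * catalan j`. Catalan estimates and absorption
of `1 / ((i + 1) * (j + 1))` into the binomial bound them above by a constant times `K ^ n * n ^
(-5/2)`, with `K = 16` or `8`; a polynomial loss gives a lower bound. Hence the radius is `1 / K`,
and the derivative at `1 / K` is dominated by the series of `n ^ (-3/2)`.

Monotonicity and continuity use only that the coefficients are polynomials `p` over `ℕ` of degree at
most `2 * n`: for `0 < x ≤ y`, `p x ≤ p y ≤ (y / x) ^ (2 * n) * p x`. The same argument in the
variable `a + 1` handles the positive case. The general lower bound on the radius forgets the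
quadrant and counts all words by a transfer matrix with eigenvalue `2 + √(2 + 2 * a)`. -/

/-! ### Sums over words -/

/-- The sum of `g` over all words of length `m`. -/
noncomputable def wordSum (m : ℕ) (g : List LatticeStep → ℝ) : ℝ :=
  ∑ w : List.Vector LatticeStep m, g w.toList

theorem wordSum_zero (g : List LatticeStep → ℝ) : wordSum 0 g = g [] := by
  unfold wordSum
  rw [Fintype.sum_eq_single (List.Vector.nil)]
  · rfl
  · exact fun v hv => absurd v.eq_nil hv

theorem wordSum_succ (m : ℕ) (g : List LatticeStep → ℝ) :
    wordSum (m + 1) g = ∑ x, wordSum m fun w => g (x :: w) := by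
  unfold wordSum
  rw [← Fintype.sum_prod_type']
  refine (Fintype.sum_equiv
    { toFun := fun p : LatticeStep × List.Vector LatticeStep m => List.Vector.cons p.1 p.2
      invFun := fun v => (v.head, v.tail)
      left_inv := fun p => by simp
      right_inv := fun v => by simp } _ _ fun p => ?_).symm
  simp

theorem sum_latticeStep (f : LatticeStep → ℝ) :
    ∑ x, f x = f .E + f .N + f .W + f .S := by
  have : (Finset.univ : Finset LatticeStep) = {.E, .N, .W, .S} := rfl
  rw [this]
  simp [add_assoc]

theorem wordSum_add (m : ℕ) (f g : List LatticeStep → ℝ) :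
    wordSum m (fun w => f w + g w) = wordSum m f + wordSum m g :=
  Finset.sum_add_distrib

theorem wordSum_mul_left (m : ℕ) (c : ℝ) (f : List LatticeStep → ℝ) :
    wordSum m (fun w => c * f w) = c * wordSum m f :=
  (Finset.mul_sum _ _ _).symm

theorem wordSum_const_zero (m : ℕ) : wordSum m (fun _ => 0) = 0 :=
  Finset.sum_const_zero

theorem wordSum_sum {ι : Type*} (m : ℕ) (s : Finset ι) (f : ι → List LatticeStep → ℝ) :
    wordSum m (fun w => ∑ i ∈ s, f i w) = ∑ i ∈ s, wordSum m (f i) :=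
  Finset.sum_comm

theorem wordSum_nonneg (m : ℕ) (f : List LatticeStep → ℝ) (hf : ∀ w, 0 ≤ f w) :
    0 ≤ wordSum m f :=
  Finset.sum_nonneg fun _ _ => hf _

theorem wordSum_mono (m : ℕ) (f g : List LatticeStep → ℝ) (h : ∀ w, f w ≤ g w) :
    wordSum m f ≤ wordSum m g :=
  Finset.sum_le_sum fun _ _ => h _

theorem wordSum_congr (m : ℕ) (f g : List LatticeStep → ℝ) (h : ∀ w, w.length = m → f w = g w) :
    wordSum m f = wordSum m g :=
  Finset.sum_congr rfl fun w _ => h _ w.toList_length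

/-! ### Corners -/

theorem cornerCount_nil : cornerCount [] = 0 := rfl

theorem cornerCount_singleton (x : LatticeStep) : cornerCount [x] = 0 := by
  simp [cornerCount]

theorem cornerCount_cons_cons (x y : LatticeStep) (w : List LatticeStep) :
    cornerCount (x :: y :: w) =
      cornerCount (y :: w) + if (x = .N ∧ y = .W) ∨ (x = .E ∧ y = .S) then 1 else 0 := by
  simp [cornerCount, List.countP_cons]

theorem cornerCount_le_length (w : List LatticeStep) : cornerCount w ≤ w.length := by
  unfold cornerCount
  refine List.countP_le_length.trans ?_
  simp

theorem cornerCount_cons_W (w : List LatticeStep) : cornerCount (.W :: w) = cornerCount w := by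
  cases w <;> simp [cornerCount_cons_cons, cornerCount_singleton, cornerCount_nil]

theorem cornerCount_cons_S (w : List LatticeStep) : cornerCount (.S :: w) = cornerCount w := by
  cases w <;> simp [cornerCount_cons_cons, cornerCount_singleton, cornerCount_nil]

/-! ### Horizontal and vertical projections -/

open DyckStep in
/-- The horizontal steps of a word. -/
def horizontalSteps (w : List LatticeStep) : List DyckStep :=
  w.filterMap fun
    | .E => some U
    | .W => some D
    | _ => none

open DyckStep in
/-- The vertical steps of a word. -/
def verticalSteps (w : List LatticeStep) : List DyckStep :=
  w.filterMap fun
    | .N => some U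
    | .S => some D
    | _ => none

section simps
variable (w : List LatticeStep)

@[simp] theorem horizontalSteps_nil : horizontalSteps [] = [] := rfl
@[simp] theorem horizontalSteps_E : horizontalSteps (.E :: w) = .U :: horizontalSteps w := rfl
@[simp] theorem horizontalSteps_W : horizontalSteps (.W :: w) = .D :: horizontalSteps w := rfl
@[simp] theorem horizontalSteps_N : horizontalSteps (.N :: w) = horizontalSteps w := rfl
@[simp] theorem horizontalSteps_S : horizontalSteps (.S :: w) = horizontalSteps w := rfl
@[simp] theorem verticalSteps_nil : verticalSteps [] = [] := rfl
@[simp] theorem verticalSteps_E : verticalSteps (.E :: w) = verticalSteps w := rfl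
@[simp] theorem verticalSteps_W : verticalSteps (.W :: w) = verticalSteps w := rfl
@[simp] theorem verticalSteps_N : verticalSteps (.N :: w) = .U :: verticalSteps w := rfl
@[simp] theorem verticalSteps_S : verticalSteps (.S :: w) = .D :: verticalSteps w := rfl

end simps

theorem length_horizontalSteps_add_length_verticalSteps (w : List LatticeStep) :
    (horizontalSteps w).length + (verticalSteps w).length = w.length := by
  induction w with
  | nil => rfl
  | cons x w ih => cases x <;> simp <;> omega

theorem walkEnd_eq (w : List LatticeStep) :
    walkEnd w = (((horizontalSteps w).count .U : ℤ) - (horizontalSteps w).count .D,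
      ((verticalSteps w).count .U : ℤ) - (verticalSteps w).count .D) := by
  induction w with
  | nil => rfl
  | cons x w ih =>
    have : walkEnd (x :: w) = x.vec + walkEnd w := by simp [walkEnd]
    rw [this, ih]
    cases x <;> simp [LatticeStep.vec] <;> ring

theorem exists_dyckWord_iff (l : List DyckStep) :
    (∃ p : DyckWord, p.toList = l) ↔
      l.count .U = l.count .D ∧ ∀ p, p <+: l → p.count .D ≤ p.count .U := by
  constructor
  · rintro ⟨p, rfl⟩
    refine ⟨p.count_U_eq_count_D, fun q hq => ?_⟩
    rw [List.prefix_iff_eq_take.1 hq]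
    exact p.count_D_le_count_U _
  · rintro ⟨h1, h2⟩
    exact ⟨⟨l, h1, fun i => h2 _ (List.take_prefix _ _)⟩, rfl⟩

/-- Each coordinate sees only its own steps, and the prefixes of a projection are exactly the
projections of prefixes, so the two sign conditions decouple. -/
theorem isQuarterPlaneLoop_iff (w : List LatticeStep) :
    IsQuarterPlaneLoop w ↔ (∃ p : DyckWord, p.toList = horizontalSteps w) ∧
      ∃ q : DyckWord, q.toList = verticalSteps w := by
  rw [exists_dyckWord_iff, exists_dyckWord_iff]
  have h1 : (∀ p, p <+: horizontalSteps w → p.count .D ≤ p.count .U) ↔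
      ∀ p, p <+: w → (horizontalSteps p).count .D ≤ (horizontalSteps p).count .U := by
    constructor
    · exact fun h p hp => h _ (List.prefix_filterMap_iff.2 ⟨p, hp, rfl⟩)
    · intro h p hp
      obtain ⟨q, hq, rfl⟩ := List.prefix_filterMap_iff.1 hp
      exact h q hq
  have h2 : (∀ p, p <+: verticalSteps w → p.count .D ≤ p.count .U) ↔
      ∀ p, p <+: w → (verticalSteps p).count .D ≤ (verticalSteps p).count .U := by
    constructor
    · exact fun h p hp => h _ (List.prefix_filterMap_iff.2 ⟨p, hp, rfl⟩)
    · intro h p hp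
      obtain ⟨q, hq, rfl⟩ := List.prefix_filterMap_iff.1 hp
      exact h q hq
  rw [h1, h2, IsQuarterPlaneLoop, IsQuarterPlaneWalk]
  simp only [walkEnd_eq, List.mem_inits, Prod.mk_eq_zero, sub_nonneg, sub_eq_zero, Nat.cast_le,
    Nat.cast_inj, forall_and]
  tauto

/-! ### Dyck words of given semilength -/

/-- The Dyck words of semilength `n`, as lists. -/
noncomputable def dyckLists (n : ℕ) : Finset (List DyckStep) :=
  (Finset.univ : Finset {p : DyckWord // p.semilength = n}).image fun p => p.1.toList

theorem mem_dyckLists (n : ℕ) (l : List DyckStep) :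
    l ∈ dyckLists n ↔ (∃ p : DyckWord, p.toList = l) ∧ l.length = 2 * n := by
  simp only [dyckLists, Finset.mem_image, Finset.mem_univ, true_and, Subtype.exists]
  constructor
  · rintro ⟨p, rfl, rfl⟩
    exact ⟨⟨p, rfl⟩, p.two_mul_semilength_eq_length.symm⟩
  · rintro ⟨⟨p, rfl⟩, h⟩
    refine ⟨p, ?_, rfl⟩
    have := p.two_mul_semilength_eq_length
    omega

theorem card_dyckLists (n : ℕ) : (dyckLists n).card = catalan n := by
  rw [dyckLists, Finset.card_image_of_injective, Finset.card_univ,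
    DyckWord.card_dyckWord_semilength_eq_catalan]
  intro p q h
  exact Subtype.ext (DyckWord.ext h)

theorem count_of_mem_dyckLists {n : ℕ} {l : List DyckStep} (h : l ∈ dyckLists n) :
    l.count .U = n ∧ l.count .D = n := by
  obtain ⟨⟨p, rfl⟩, h⟩ := (mem_dyckLists n l).1 h
  have h1 := p.two_mul_semilength_eq_length
  have h2 := p.semilength_eq_count_D
  have h3 : p.semilength = p.toList.count .U := rfl
  omega

/-- The indicator of quarter plane loops, as a sum over pairs of Dyck words. -/
theorem sum_dyckLists_eq_ite (n : ℕ) (w : List LatticeStep) (hw : w.length = 2 * n) :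
    (∑ ij ∈ Finset.HasAntidiagonal.antidiagonal n, ∑ α ∈ dyckLists ij.1, ∑ β ∈ dyckLists ij.2,
      if horizontalSteps w = α ∧ verticalSteps w = β then (1 : ℝ) else 0) =
      if IsQuarterPlaneLoop w then 1 else 0 := by
  have hlen := length_horizontalSteps_add_length_verticalSteps w
  simp only [ite_and, Finset.sum_ite_eq, Finset.sum_ite_irrel, Finset.sum_const_zero]
  simp only [← ite_and]
  by_cases h : IsQuarterPlaneLoop w
  · rw [if_pos h]
    obtain ⟨⟨p, hp⟩, q, hq⟩ := (isQuarterPlaneLoop_iff w).1 h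
    have h1 := p.two_mul_semilength_eq_length
    have h2 := q.two_mul_semilength_eq_length
    rw [hp] at h1
    rw [hq] at h2
    -- The lengths of the projections determine the only contributing pair of semilengths.
    rw [Finset.sum_eq_single (p.semilength, q.semilength)]
    · rw [if_pos]
      exact ⟨(mem_dyckLists _ _).2 ⟨⟨p, hp⟩, h1.symm⟩, (mem_dyckLists _ _).2 ⟨⟨q, hq⟩, h2.symm⟩⟩
    · rintro ⟨i, j⟩ _ hne
      rw [if_neg]
      rintro ⟨ha, hb⟩
      have ha := ((mem_dyckLists _ _).1 ha).2
      have hb := ((mem_dyckLists _ _).1 hb).2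
      apply hne
      simp only [Prod.mk.injEq] at ha hb ⊢
      omega
    · intro h
      exfalso
      apply h
      rw [Finset.HasAntidiagonal.mem_antidiagonal]
      simp only
      omega
  · rw [if_neg h]
    refine Finset.sum_eq_zero fun ij _ => if_neg ?_
    rintro ⟨ha, hb⟩
    exact h <| (isQuarterPlaneLoop_iff w).2
      ⟨((mem_dyckLists _ _).1 ha).1, ((mem_dyckLists _ _).1 hb).1⟩

/-! ### Shuffles weighted by corners -/

/-- The sum of `a ^ cornerCount w` over the words `w` with given projections. -/
noncomputable def shuffleSum (a : ℝ) (α β : List DyckStep) : ℝ :=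
  wordSum (α.length + β.length) fun w =>
    if horizontalSteps w = α ∧ verticalSteps w = β then a ^ cornerCount w else 0

theorem shuffleSum_nonneg {a : ℝ} (ha : 0 ≤ a) (α β : List DyckStep) : 0 ≤ shuffleSum a α β :=
  wordSum_nonneg _ _ fun w => by split_ifs <;> positivity

theorem coeff_seriesQAt (a : ℝ) (n : ℕ) :
    PowerSeries.coeff n (seriesQAt a) =
      wordSum (2 * n) fun w => if IsQuarterPlaneLoop w then a ^ cornerCount w else 0 := by
  simp only [seriesQAt, seriesQ, quarterPlaneLoops, wordSum, Finset.sum_filter,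
    PowerSeries.coeff_map, PowerSeries.coeff_mk, map_sum]
  refine Finset.sum_congr rfl fun w _ => ?_
  split_ifs <;> simp

theorem coeff_seriesQAt_eq_sum_shuffleSum (a : ℝ) (n : ℕ) :
    PowerSeries.coeff n (seriesQAt a) =
      ∑ ij ∈ Finset.HasAntidiagonal.antidiagonal n, ∑ α ∈ dyckLists ij.1, ∑ β ∈ dyckLists ij.2,
        shuffleSum a α β := by
  have h1 : ∀ w : List LatticeStep, w.length = 2 * n →
      (if IsQuarterPlaneLoop w then a ^ cornerCount w else 0) =
      ∑ ij ∈ Finset.HasAntidiagonal.antidiagonal n, ∑ α ∈ dyckLists ij.1, ∑ β ∈ dyckLists ij.2,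
        if horizontalSteps w = α ∧ verticalSteps w = β then a ^ cornerCount w else 0 := by
    intro w hw
    have := sum_dyckLists_eq_ite n w hw
    rw [← mul_boole, ← this]
    simp only [Finset.mul_sum, mul_boole]
  rw [coeff_seriesQAt, wordSum_congr _ _ _ h1, wordSum_sum]
  refine Finset.sum_congr rfl fun ij hij => ?_
  rw [wordSum_sum]
  refine Finset.sum_congr rfl fun α hα => ?_
  rw [wordSum_sum]
  refine Finset.sum_congr rfl fun β hβ => ?_
  rw [shuffleSum, ((mem_dyckLists _ _).1 hα).2, ((mem_dyckLists _ _).1 hβ).2, ← mul_add,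
    Finset.HasAntidiagonal.mem_antidiagonal.1 hij]

/-- There is a single such word, and it has no corner because a corner needs both a horizontal and a
vertical step. -/
theorem shuffleSum_nil_left (a : ℝ) (β : List DyckStep) : shuffleSum a [] β = 1 := by
  induction β with
  | nil => simp [shuffleSum, wordSum_zero, cornerCount_nil]
  | cons y β ih =>
    rw [← ih]
    have hN : ∀ w, horizontalSteps w = [] → cornerCount (.N :: w) = cornerCount w := by
      intro w hw
      cases w with
      | nil => rfl
      | cons z w => cases z <;> simp_all [cornerCount_cons_cons]
    simp only [shuffleSum, List.length_nil, zero_add, List.length_cons]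
    rw [wordSum_succ, sum_latticeStep]
    cases y
    · simp [wordSum_const_zero]
      refine wordSum_congr _ _ _ fun w _ => ?_
      split_ifs with h
      · rw [hN w h.1]
      · rfl
    · simp [wordSum_const_zero, cornerCount_cons_S]

theorem shuffleSum_nil_right (a : ℝ) (α : List DyckStep) : shuffleSum a α [] = 1 := by
  induction α with
  | nil => simp [shuffleSum, wordSum_zero, cornerCount_nil]
  | cons y β ih =>
    rw [← ih]
    have hN : ∀ w, verticalSteps w = [] → cornerCount (.E :: w) = cornerCount w := by
      intro w hw
      cases w with
      | nil => rfl
      | cons z w => cases z <;> simp_all [cornerCount_cons_cons]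
    simp only [shuffleSum, List.length_nil, add_zero, List.length_cons]
    rw [wordSum_succ, sum_latticeStep]
    cases y
    · simp [wordSum_const_zero]
      refine wordSum_congr _ _ _ fun w _ => ?_
      split_ifs with h
      · rw [hN w h.2]
      · rfl
    · simp [wordSum_const_zero, cornerCount_cons_W]

theorem pow_cornerCount_cons_E (a : ℝ) (w : List LatticeStep) :
    a ^ cornerCount (.E :: w) =
      a ^ cornerCount w + (a - 1) * if w.head? = some .S then a ^ cornerCount w else 0 := by
  cases w with
  | nil => simp [cornerCount]
  | cons z w => cases z <;> simp [cornerCount_cons_cons, pow_succ] ; ring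

theorem pow_cornerCount_cons_N (a : ℝ) (w : List LatticeStep) :
    a ^ cornerCount (.N :: w) =
      a ^ cornerCount w + (a - 1) * if w.head? = some .W then a ^ cornerCount w else 0 := by
  cases w with
  | nil => simp [cornerCount]
  | cons z w => cases z <;> simp [cornerCount_cons_cons, pow_succ] ; ring

/-- Prepending `E` creates a corner exactly when the next step is `S`. This is possible only for `y
= .D`, and deleting that `S` leaves a shuffle of `α` and `β`. -/
theorem wordSum_cons_E (a : ℝ) (α β : List DyckStep) (y : DyckStep) :
    (wordSum (α.length + β.length + 1) fun w =>
      if horizontalSteps w = α ∧ verticalSteps w = y :: β then a ^ cornerCount (.E :: w) else 0) =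
      shuffleSum a α (y :: β) + if y = .D then (a - 1) * shuffleSum a α β else 0 := by
  have h : ∀ w, (if horizontalSteps w = α ∧ verticalSteps w = y :: β
      then a ^ cornerCount (.E :: w) else 0) =
      (if horizontalSteps w = α ∧ verticalSteps w = y :: β then a ^ cornerCount w else 0) +
      (a - 1) * if w.head? = some .S ∧ horizontalSteps w = α ∧ verticalSteps w = y :: β
        then a ^ cornerCount w else 0 := by
    intro w
    rw [pow_cornerCount_cons_E]
    split_ifs <;> simp_all
  rw [wordSum_congr _ _ _ fun w _ => h w, wordSum_add, wordSum_mul_left]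
  congr 1
  rw [wordSum_succ, sum_latticeStep]
  cases y <;> simp [wordSum_const_zero, cornerCount_cons_S, shuffleSum]

theorem wordSum_cons_N (a : ℝ) (α β : List DyckStep) (x : DyckStep) :
    (wordSum (α.length + β.length + 1) fun w =>
      if horizontalSteps w = x :: α ∧ verticalSteps w = β then a ^ cornerCount (.N :: w) else 0) =
      shuffleSum a (x :: α) β + if x = .D then (a - 1) * shuffleSum a α β else 0 := by
  have h : ∀ w, (if horizontalSteps w = x :: α ∧ verticalSteps w = β
      then a ^ cornerCount (.N :: w) else 0) =
      (if horizontalSteps w = x :: α ∧ verticalSteps w = β then a ^ cornerCount w else 0) +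
      (a - 1) * if w.head? = some .W ∧ horizontalSteps w = x :: α ∧ verticalSteps w = β
        then a ^ cornerCount w else 0 := by
    intro w
    rw [pow_cornerCount_cons_N]
    split_ifs <;> simp_all
  rw [wordSum_congr _ _ _ fun w _ => h w, wordSum_add, wordSum_mul_left]
  congr 1
  · simp [shuffleSum, add_right_comm]
  rw [wordSum_succ, sum_latticeStep]
  cases x <;> simp [wordSum_const_zero, cornerCount_cons_W, shuffleSum]

/-- The word starts with the step of `x` or that of `y`. A corner at its first two steps consumes
both: `ES` is the case `x = U`, `y = D`, and `NW` is `x = D`, `y = U`. Equal letters give no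
correction. -/
theorem shuffleSum_cons_cons (a : ℝ) (x y : DyckStep) (α β : List DyckStep) :
    shuffleSum a (x :: α) (y :: β) = shuffleSum a α (y :: β) + shuffleSum a (x :: α) β +
      if x = y then 0 else (a - 1) * shuffleSum a α β := by
  have hE := wordSum_cons_E a α β y
  have hN := wordSum_cons_N a α β x
  have hW : (wordSum (α.length + β.length + 1) fun w =>
      if horizontalSteps w = α ∧ verticalSteps w = y :: β then a ^ cornerCount w else 0) =
      shuffleSum a α (y :: β) := rfl
  have hS : (wordSum (α.length + β.length + 1) fun w =>
      if horizontalSteps w = x :: α ∧ verticalSteps w = β then a ^ cornerCount w else 0) =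
      shuffleSum a (x :: α) β := by simp [shuffleSum, add_right_comm]
  have hlen : (x :: α).length + (y :: β).length = α.length + β.length + 1 + 1 := by
    simp only [List.length_cons]; omega
  rw [shuffleSum, hlen, wordSum_succ, sum_latticeStep]
  cases x <;> cases y <;>
    simp [wordSum_const_zero, cornerCount_cons_W, cornerCount_cons_S] at hE hN hW hS ⊢ <;>
    linarith

/-! ### Closed forms of the shuffle sums for `a = ±1` -/

theorem shuffleSum_one (α β : List DyckStep) :
    shuffleSum 1 α β = (α.length + β.length).choose α.length := by
  induction α generalizing β with
  | nil => simp [shuffleSum_nil_left]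
  | cons x α ih =>
    induction β with
    | nil => simp [shuffleSum_nil_right]
    | cons y β ih' =>
      rw [shuffleSum_cons_cons, ih, ih']
      simp only [List.length_cons, sub_self, zero_mul, ite_self, add_zero]
      rw [show α.length + 1 + (β.length + 1) = (α.length + (β.length + 1)) + 1 by ring,
        Nat.choose_succ_succ, show α.length + 1 + β.length = α.length + (β.length + 1) by ring]
      push_cast
      rfl

/-- The sign of a step of a Dyck word. -/
def DyckStep.sign : DyckStep → ℝ
  | .U => 1
  | .D => -1

open Polynomial in
/-- For `a = -1` the shuffle sum is a coefficient of a product of linear factors; in particular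
it depends on the two projections only through their letter counts. -/
theorem shuffleSum_neg_one (α β : List DyckStep) :
    shuffleSum (-1) α β = ((α.map fun x : DyckStep => (1 - C x.sign * X : ℝ[X])).prod *
      (β.map fun y : DyckStep => (X - C y.sign : ℝ[X])).prod).coeff β.length := by
  induction α generalizing β with
  | nil =>
    rw [shuffleSum_nil_left]
    have hm : ∀ l : List DyckStep, (l.map fun y => (X - C y.sign : ℝ[X])).prod.Monic ∧
        (l.map fun y => (X - C y.sign : ℝ[X])).prod.natDegree = l.length := by
      intro l
      induction l with
      | nil => simp
      | cons y l ih =>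
        refine ⟨by simpa using (monic_X_sub_C _).mul ih.1, ?_⟩
        rw [List.map_cons, List.prod_cons, (monic_X_sub_C _).natDegree_mul ih.1, ih.2,
          natDegree_X_sub_C, List.length_cons, add_comm]
    obtain ⟨h1, h2⟩ := hm β
    rw [List.map_nil, List.prod_nil, one_mul, ← h2]
    exact h1.coeff_natDegree.symm
  | cons x α ih =>
    induction β with
    | nil =>
      rw [shuffleSum_nil_right, List.length_nil, coeff_zero_eq_eval_zero]
      clear ih
      generalize x :: α = l
      simp only [List.map_nil, List.prod_nil, mul_one]
      induction l with
      | nil => simp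
      | cons z l ih => simp [← ih]
    | cons y β ih' =>
      rw [shuffleSum_cons_cons, ih, ih', ih]
      simp only [List.map_cons, List.prod_cons, List.length_cons]
      generalize (α.map fun x : DyckStep => (1 - C x.sign * X : ℝ[X])).prod = P
      generalize (β.map fun y : DyckStep => (X - C y.sign : ℝ[X])).prod = Q
      -- With signs `ε`, `δ`, the factor `1 - ε * δ` is `0` or `2`, so the correction becomes
      -- polynomial. The recursion is then `(1 - ε * X) * (X - δ) = (X - δ) + X * (1 - ε * X) - (1 -
      -- ε * δ) * X`.
      have hχ : (if x = y then (0 : ℝ) else (-1 - 1) * (P * Q).coeff β.length) =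
          -(1 - x.sign * y.sign) * (P * Q).coeff β.length := by
        cases x <;> cases y <;> norm_num [DyckStep.sign] <;>
          exact fun h => nomatch h
      rw [hχ, ← coeff_X_mul ((1 - C x.sign * X) * P * Q), ← coeff_X_mul (P * Q), ← coeff_C_mul,
        ← coeff_add, ← coeff_add]
      congr 1
      simp only [C_neg, C_sub, C_mul, C_1]
      ring

theorem prod_map_dyckStep {R : Type*} [CommRing R] (f : DyckStep → R) (l : List DyckStep) :
    (l.map f).prod = f .U ^ l.count .U * f .D ^ l.count .D := by
  induction l with
  | nil => simp
  | cons x l ih => cases x <;> simp [ih, pow_succ] <;> ring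

-- Balanced letter counts turn the product into `(1 - X ^ 2) ^ i * (X ^ 2 - 1) ^ j = (-1) ^ j * (1 -
-- X ^ 2) ^ (i + j)`, and the sign cancels in the coefficient of `X ^ (2 * j)`.
open Polynomial in
theorem shuffleSum_neg_one_of_mem {i j : ℕ} {α β : List DyckStep} (hα : α ∈ dyckLists i)
    (hβ : β ∈ dyckLists j) : shuffleSum (-1) α β = (i + j).choose i := by
  obtain ⟨h1, h2⟩ := count_of_mem_dyckLists hα
  obtain ⟨h3, h4⟩ := count_of_mem_dyckLists hβ
  rw [shuffleSum_neg_one, prod_map_dyckStep, prod_map_dyckStep, h1, h2, h3, h4,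
    ((mem_dyckLists _ _).1 hβ).2, ← mul_pow, ← mul_pow]
  have e1 : ((1 - C DyckStep.U.sign * X) * (1 - C DyckStep.D.sign * X) : ℝ[X]) =
      expand ℝ 2 (1 - X) := by
    simp [DyckStep.sign]; ring
  have e2 : ((X - C DyckStep.U.sign) * (X - C DyckStep.D.sign) : ℝ[X]) =
      expand ℝ 2 (-(1 - X)) := by
    simp [DyckStep.sign]; ring
  have e3 : (1 - X : ℝ[X]) ^ (i + j) = ((1 + X : ℝ[X]) ^ (i + j)).comp (C (-1) * X) := by
    simp [sub_eq_add_neg]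
  rw [e1, e2, ← map_pow, ← map_pow, ← map_mul, mul_comm 2 j, coeff_expand_mul two_pos,
    neg_pow, mul_left_comm, ← pow_add, e3, ← C_1, ← C_neg, ← C_pow, coeff_C_mul,
    comp_C_mul_X_coeff, C_1, coeff_one_add_X_pow, mul_left_comm, ← mul_pow,
    Nat.choose_symm_of_eq_add (Nat.add_comm i j)]
  simp

theorem coeff_seriesQAt_one (n : ℕ) : PowerSeries.coeff n (seriesQAt 1) =
    ∑ ij ∈ Finset.HasAntidiagonal.antidiagonal n,
      ((2 * n).choose (2 * ij.1) : ℝ) * (catalan ij.1 * catalan ij.2) := by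
  rw [coeff_seriesQAt_eq_sum_shuffleSum]
  refine Finset.sum_congr rfl fun ij hij => ?_
  rw [← Finset.HasAntidiagonal.mem_antidiagonal.1 hij, ← card_dyckLists, ← card_dyckLists]
  have : ∀ α ∈ dyckLists ij.1, ∀ β ∈ dyckLists ij.2,
      shuffleSum 1 α β = (2 * (ij.1 + ij.2)).choose (2 * ij.1) := by
    intro α hα β hβ
    rw [shuffleSum_one, ((mem_dyckLists _ _).1 hα).2, ((mem_dyckLists _ _).1 hβ).2, mul_add]
  rw [Finset.sum_congr rfl fun α hα => Finset.sum_congr rfl (this α hα)]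
  simp only [Finset.sum_const, nsmul_eq_mul]
  ring

theorem coeff_seriesQAt_neg_one (n : ℕ) : PowerSeries.coeff n (seriesQAt (-1)) =
    ∑ ij ∈ Finset.HasAntidiagonal.antidiagonal n,
      (n.choose ij.1 : ℝ) * (catalan ij.1 * catalan ij.2) := by
  rw [coeff_seriesQAt_eq_sum_shuffleSum]
  refine Finset.sum_congr rfl fun ij hij => ?_
  rw [← Finset.HasAntidiagonal.mem_antidiagonal.1 hij, ← card_dyckLists, ← card_dyckLists]
  rw [Finset.sum_congr rfl fun α hα => Finset.sum_congr rfl fun β hβ =>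
    shuffleSum_neg_one_of_mem hα hβ]
  simp only [Finset.sum_const, nsmul_eq_mul]
  ring

theorem one_le_catalan (n : ℕ) : 1 ≤ catalan n := by
  rw [Nat.one_le_iff_ne_zero]
  intro h
  have := succ_mul_catalan_eq_centralBinom n
  rw [h] at this
  exact n.centralBinom_ne_zero (by omega)

/-- A purely horizontal loop has no corner, so it alone contributes `1`. -/
theorem one_le_coeff_seriesQAt {a : ℝ} (ha : 0 ≤ a) (n : ℕ) :
    1 ≤ PowerSeries.coeff n (seriesQAt a) := by
  obtain ⟨α, hα⟩ : (dyckLists n).Nonempty := by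
    rw [← Finset.card_pos, card_dyckLists]
    exact one_le_catalan n
  have hβ : ([] : List DyckStep) ∈ dyckLists 0 :=
    (mem_dyckLists _ _).2 ⟨⟨0, rfl⟩, List.length_nil⟩
  have h0 : ∀ j α, 0 ≤ ∑ β ∈ dyckLists j, shuffleSum a α β := fun j α =>
    Finset.sum_nonneg fun β _ => shuffleSum_nonneg ha α β
  have h1 : shuffleSum a α [] ≤ ∑ β ∈ dyckLists 0, shuffleSum a α β :=
    Finset.single_le_sum (f := fun β => shuffleSum a α β)
      (fun β _ => shuffleSum_nonneg ha α β) hβ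
  have h2 : ∑ β ∈ dyckLists 0, shuffleSum a α β ≤
      ∑ α ∈ dyckLists n, ∑ β ∈ dyckLists 0, shuffleSum a α β :=
    Finset.single_le_sum (f := fun α => ∑ β ∈ dyckLists 0, shuffleSum a α β)
      (fun α _ => h0 0 α) hα
  have hmem : (n, 0) ∈ Finset.HasAntidiagonal.antidiagonal n :=
    Finset.HasAntidiagonal.mem_antidiagonal.2 (Nat.add_zero n)
  have h3 := Finset.single_le_sum
    (f := fun ij : ℕ × ℕ => ∑ α ∈ dyckLists ij.1, ∑ β ∈ dyckLists ij.2, shuffleSum a α β)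
    (fun ij _ => Finset.sum_nonneg fun α _ => h0 ij.2 α) hmem
  rw [← coeff_seriesQAt_eq_sum_shuffleSum] at h3
  rw [shuffleSum_nil_right] at h1
  exact h1.trans (h2.trans h3)

/-! ### Radii of convergence -/

theorem norm_ofScalars_coeff (F : PowerSeries ℝ) (n : ℕ) :
    ‖FormalMultilinearSeries.ofScalars ℝ (fun n => PowerSeries.coeff n F) n‖ =
      |PowerSeries.coeff n F| :=
  FormalMultilinearSeries.ofScalars_norm _ _ _

theorem le_convergenceRadius_of_bound {F : PowerSeries ℝ} {r C : ℝ} (hr : 0 ≤ r)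
    (h : ∀ n, |PowerSeries.coeff n F| * r ^ n ≤ C) : ENNReal.ofReal r ≤ convergenceRadius F := by
  lift r to NNReal using hr
  rw [ENNReal.ofReal_coe_nnreal]
  refine FormalMultilinearSeries.le_radius_of_bound _ C fun n => ?_
  rw [norm_ofScalars_coeff]
  exact h n

theorem exists_bound_of_lt_convergenceRadius {F : PowerSeries ℝ} {r : NNReal}
    (h : (r : ℝ≥0∞) < convergenceRadius F) :
    ∃ C, ∀ n, |PowerSeries.coeff n F| * (r : ℝ) ^ n ≤ C := by
  obtain ⟨C, -, hC⟩ := FormalMultilinearSeries.norm_mul_pow_le_of_lt_radius _ h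
  exact ⟨C, fun n => by simpa only [norm_ofScalars_coeff] using hC n⟩

theorem convergenceRadius_le_mul {F G : PowerSeries ℝ} {c : ℝ} (hc : 0 < c)
    (h : ∀ n, |PowerSeries.coeff n G| ≤ c ^ n * |PowerSeries.coeff n F|) :
    convergenceRadius F ≤ ENNReal.ofReal c * convergenceRadius G := by
  refine ENNReal.le_of_forall_nnreal_lt fun r hr => ?_
  obtain ⟨C, hC⟩ := exists_bound_of_lt_convergenceRadius hr
  have hG : ENNReal.ofReal (r / c) ≤ convergenceRadius G := by
    refine le_convergenceRadius_of_bound (by positivity) (C := C) fun n => ?_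
    refine le_trans ?_ (hC n)
    rw [div_pow]
    calc |PowerSeries.coeff n G| * (r ^ n / c ^ n)
        ≤ (c ^ n * |PowerSeries.coeff n F|) * (r ^ n / c ^ n) := by gcongr; exact h n
      _ = _ := by field_simp
  calc (r : ℝ≥0∞) = ENNReal.ofReal c * ENNReal.ofReal (r / c) := by
        rw [← ENNReal.ofReal_mul hc.le, mul_div_cancel₀ _ hc.ne', ENNReal.ofReal_coe_nnreal]
    _ ≤ _ := by gcongr

theorem convergenceRadius_anti {F G : PowerSeries ℝ}
    (h : ∀ n, |PowerSeries.coeff n G| ≤ |PowerSeries.coeff n F|) :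
    convergenceRadius F ≤ convergenceRadius G := by
  simpa using convergenceRadius_le_mul (F := F) (G := G) one_pos (by simpa using h)

/-- For `r > 1 / K` the terms could be bounded only if `(K * r) ^ n` grew at most polynomially. -/
theorem convergenceRadius_le_of_pow_le {F : PowerSeries ℝ} {K c : ℝ} {k : ℕ} (hK : 0 < K)
    (h : ∀ n : ℕ, K ^ n ≤ c * ((n : ℝ) + 1) ^ k * |PowerSeries.coeff n F|) :
    convergenceRadius F ≤ ENNReal.ofReal (1 / K) := by
  have hc : 0 ≤ c := by
    have h0 := h 0
    by_contra! hc
    simp only [pow_zero, Nat.cast_zero, zero_add, one_pow, mul_one] at h0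
    nlinarith [abs_nonneg (PowerSeries.coeff 0 F)]
  refine ENNReal.le_of_forall_nnreal_lt fun r hr => ?_
  by_contra! hlt
  obtain ⟨C, hC⟩ := exists_bound_of_lt_convergenceRadius hr
  have hr1 : 1 / K < r := by
    rw [← ENNReal.ofReal_coe_nnreal] at hlt
    exact (ENNReal.ofReal_lt_ofReal_iff_of_nonneg (by positivity)).1 hlt
  have hKr : 1 < K * r := by
    rw [div_lt_iff₀ hK] at hr1
    linarith
  have hb : ∀ n : ℕ, (K * r) ^ n ≤ c * ((n : ℝ) + 1) ^ k * C := fun n => by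
    rw [mul_pow]
    calc K ^ n * (r : ℝ) ^ n ≤ c * ((n : ℝ) + 1) ^ k * |PowerSeries.coeff n F| * r ^ n := by
          gcongr; exact h n
      _ = c * ((n : ℝ) + 1) ^ k * (|PowerSeries.coeff n F| * r ^ n) := by ring
      _ ≤ _ := by gcongr; exact hC n
  -- The extra factor `K * r` compensates for the shift from `n` to `n + 1` below.
  have ht := (tendsto_pow_const_div_const_pow_of_one_lt k hKr).const_mul (c * C * (K * r))
  rw [mul_zero] at ht
  have ht := ht.comp (Filter.tendsto_add_atTop_nat 1)
  obtain ⟨n, hn⟩ := (ht.eventually (gt_mem_nhds one_pos)).exists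
  have hn' : c * C * (K * r) * (((n + 1 : ℕ) : ℝ) ^ k / (K * r) ^ (n + 1)) < 1 := hn
  have hpos : 0 < (K * (r : ℝ)) ^ n := by positivity
  rw [pow_succ] at hn'
  have e : c * C * (K * r) * (((n + 1 : ℕ) : ℝ) ^ k / ((K * r) ^ n * (K * r))) =
      c * ((n : ℝ) + 1) ^ k * C / (K * r) ^ n := by
    have hr0 : (r : ℝ) ≠ 0 := fun h0 => by simp [h0] at hKr; linarith
    push_cast
    field_simp
  rw [e, div_lt_one hpos] at hn'
  exact absurd (hb n) (not_le.2 hn')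

/-! ### Series with nonnegative coefficients in the parameter -/

/-- The power series obtained by evaluating a sequence of polynomials at `x`. -/
noncomputable def evalSeries (P : ℕ → Polynomial ℕ) (x : ℝ) : PowerSeries ℝ :=
  PowerSeries.mk fun n => (P n).eval₂ (Nat.castRingHom ℝ) x

theorem eval₂_natCast_nonneg (p : Polynomial ℕ) {x : ℝ} (hx : 0 ≤ x) :
    0 ≤ p.eval₂ (Nat.castRingHom ℝ) x := by
  rw [Polynomial.eval₂_eq_sum_range]
  exact Finset.sum_nonneg fun i _ => by simp; positivity

theorem eval₂_natCast_mono (p : Polynomial ℕ) {x y : ℝ} (hx : 0 ≤ x) (hxy : x ≤ y) :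
    p.eval₂ (Nat.castRingHom ℝ) x ≤ p.eval₂ (Nat.castRingHom ℝ) y := by
  rw [Polynomial.eval₂_eq_sum_range, Polynomial.eval₂_eq_sum_range]
  refine Finset.sum_le_sum fun i _ => ?_
  simp only [eq_natCast]
  gcongr

theorem eval₂_natCast_le_mul (p : Polynomial ℕ) {x y : ℝ} {d : ℕ} (hd : p.natDegree ≤ d)
    (hx : 0 < x) (hxy : x ≤ y) :
    p.eval₂ (Nat.castRingHom ℝ) y ≤ (y / x) ^ d * p.eval₂ (Nat.castRingHom ℝ) x := by
  rw [Polynomial.eval₂_eq_sum_range, Polynomial.eval₂_eq_sum_range, Finset.mul_sum]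
  refine Finset.sum_le_sum fun i hi => ?_
  have hi : i ≤ d := by
    rw [Finset.mem_range] at hi
    omega
  have h1 : 1 ≤ y / x := (one_le_div hx).2 hxy
  have h2 : y ^ i = (y / x) ^ i * x ^ i := by
    rw [← mul_pow, div_mul_cancel₀ _ hx.ne']
  simp only [eq_natCast]
  rw [h2, mul_left_comm]
  gcongr

theorem antitoneOn_convergenceRadius_evalSeries (P : ℕ → Polynomial ℕ) :
    AntitoneOn (fun x => convergenceRadius (evalSeries P x)) (Set.Ici 0) := by
  intro x hx y hy hxy
  refine convergenceRadius_anti fun n => ?_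
  simp only [evalSeries, PowerSeries.coeff_mk]
  rw [abs_of_nonneg (eval₂_natCast_nonneg _ hx), abs_of_nonneg (eval₂_natCast_nonneg _ hy)]
  exact eval₂_natCast_mono _ hx hxy

theorem convergenceRadius_evalSeries_le_mul (P : ℕ → Polynomial ℕ) (d : ℕ)
    (hP : ∀ n, (P n).natDegree ≤ d * n) {x y : ℝ} (hx : 0 < x) (hxy : x ≤ y) :
    convergenceRadius (evalSeries P x) ≤
      ENNReal.ofReal ((y / x) ^ d) * convergenceRadius (evalSeries P y) := by
  have hy := hx.trans_le hxy
  refine convergenceRadius_le_mul (by positivity) fun n => ?_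
  simp only [evalSeries, PowerSeries.coeff_mk]
  rw [abs_of_nonneg (eval₂_natCast_nonneg _ hx.le), abs_of_nonneg (eval₂_natCast_nonneg _ hy.le),
    ← pow_mul]
  exact eval₂_natCast_le_mul _ (hP n) hx hxy

/-- Monotonicity and the scaling inequality squeeze `σ y` between `min 1 ((x / y) ^ d) * σ x` and
`max 1 ((x / y) ^ d) * σ x`. -/
theorem continuousOn_convergenceRadius_evalSeries (P : ℕ → Polynomial ℕ) (d : ℕ)
    (hP : ∀ n, (P n).natDegree ≤ d * n) :
    ContinuousOn (fun x => convergenceRadius (evalSeries P x)) (Set.Ioi 0) := by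
  set σ := fun x => convergenceRadius (evalSeries P x) with hσ
  intro x hx
  have hx : 0 < x := hx
  refine ContinuousAt.continuousWithinAt ?_
  have hanti : AntitoneOn σ (Set.Ici 0) := antitoneOn_convergenceRadius_evalSeries P
  have hcont : ContinuousAt (fun y : ℝ => (x / y) ^ d) x :=
    (continuousAt_const.div continuousAt_id hx.ne').pow d
  have hlim : ∀ g : ℝ → ℝ, ContinuousAt g x → g x = 1 →
      Filter.Tendsto (fun y => ENNReal.ofReal (g y) * σ x) (nhds x) (nhds (σ x)) := by
    intro g hg hgx
    have h1 : Filter.Tendsto (fun y => ENNReal.ofReal (g y)) (nhds x) (nhds 1) := by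
      rw [← ENNReal.ofReal_one, ← hgx]
      exact (ENNReal.continuous_ofReal.tendsto (g x)).comp hg
    -- The limit `1` is nonzero, so an infinite `σ x` is harmless.
    simpa using ENNReal.Tendsto.mul_const h1 (Or.inl one_ne_zero : (1 : ℝ≥0∞) ≠ 0 ∨ σ x ≠ ⊤)
  have hx1 : (x / x) ^ d = 1 := by rw [div_self hx.ne', one_pow]
  refine tendsto_of_tendsto_of_tendsto_of_le_of_le'
    (hlim (fun y => min 1 ((x / y) ^ d)) (continuousAt_const.min hcont) (by simp [hx1]))
    (hlim (fun y => max 1 ((x / y) ^ d)) (continuousAt_const.max hcont) (by simp [hx1])) ?_ ?_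
  · filter_upwards [lt_mem_nhds hx] with y hy
    rcases le_total x y with hxy | hxy
    · have h := convergenceRadius_evalSeries_le_mul P d hP hx hxy
      calc ENNReal.ofReal (min 1 ((x / y) ^ d)) * σ x
          ≤ ENNReal.ofReal ((x / y) ^ d) * (ENNReal.ofReal ((y / x) ^ d) * σ y) := by
            gcongr
            exact min_le_right _ _
        _ = σ y := by
            rw [← mul_assoc, ← ENNReal.ofReal_mul (by positivity), ← mul_pow,
              show x / y * (y / x) = 1 by field_simp, one_pow, ENNReal.ofReal_one, one_mul]
    · calc ENNReal.ofReal (min 1 ((x / y) ^ d)) * σ x ≤ 1 * σ x := by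
            gcongr
            rw [← ENNReal.ofReal_one]
            exact ENNReal.ofReal_le_ofReal (min_le_left _ _)
        _ = σ x := one_mul _
        _ ≤ σ y := hanti hy.le hx.le hxy
  · filter_upwards [lt_mem_nhds hx] with y hy
    rcases le_total x y with hxy | hxy
    · calc σ y ≤ σ x := hanti hx.le hy.le hxy
        _ = 1 * σ x := (one_mul _).symm
        _ ≤ ENNReal.ofReal (max 1 ((x / y) ^ d)) * σ x := by
            gcongr
            rw [← ENNReal.ofReal_one]
            exact ENNReal.ofReal_le_ofReal (le_max_left _ _)
    · refine (convergenceRadius_evalSeries_le_mul P d hP hy hxy).trans ?_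
      change _ * σ x ≤ _
      gcongr
      exact le_max_right _ _

theorem natDegree_coeff_seriesQ_le (n : ℕ) : (PowerSeries.coeff n seriesQ).natDegree ≤ 2 * n := by
  rw [seriesQ, PowerSeries.coeff_mk]
  refine Polynomial.natDegree_sum_le_of_forall_le _ _ fun w _ => ?_
  rw [Polynomial.natDegree_X_pow]
  exact (cornerCount_le_length _).trans w.toList_length.le

theorem seriesQAt_eq_evalSeries (a : ℝ) :
    seriesQAt a = evalSeries (fun n => PowerSeries.coeff n seriesQ) a := by
  ext n
  simp [seriesQAt, evalSeries]

theorem antitoneOn_and_continuousOn_rhoQ_of_isAddOnePositive (h : IsAddOnePositive seriesQ) :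
    AntitoneOn rhoQ (Set.Ici (-1)) ∧ ContinuousOn rhoQ (Set.Ioi (-1)) := by
  obtain ⟨P, hP⟩ := h
  have heval : ∀ a : ℝ, seriesQAt a = evalSeries P (a + 1) := by
    intro a
    ext n
    have h1 := congrArg (Polynomial.eval₂ (Int.castRingHom ℝ) a) (hP n)
    rw [Polynomial.eval₂_comp, Polynomial.eval₂_map, Polynomial.eval₂_map,
      Subsingleton.elim ((Int.castRingHom ℝ).comp (Nat.castRingHom ℤ)) (Nat.castRingHom ℝ)] at h1
    simpa [seriesQAt, evalSeries] using h1
  -- Substituting `X + 1` preserves the degree.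
  have hdeg : ∀ n, (P n).natDegree ≤ 2 * n := by
    intro n
    have h1 := congrArg Polynomial.natDegree (hP n)
    have hinj : Function.Injective (Nat.castRingHom ℤ) := Nat.cast_injective
    rw [Polynomial.natDegree_comp, Polynomial.natDegree_map_eq_of_injective hinj,
      Polynomial.natDegree_map_eq_of_injective hinj, ← Polynomial.C_1,
      Polynomial.natDegree_X_add_C, mul_one] at h1
    exact h1 ▸ natDegree_coeff_seriesQ_le n
  have hrho : rhoQ = (fun x => convergenceRadius (evalSeries P x)) ∘ fun a => a + 1 := by
    funext a
    rw [rhoQ, heval]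
    rfl
  rw [hrho]
  constructor
  · intro a ha b hb hab
    have ha : -1 ≤ a := ha
    have hb : -1 ≤ b := hb
    exact antitoneOn_convergenceRadius_evalSeries P (Set.mem_Ici.2 (by linarith))
      (Set.mem_Ici.2 (by linarith)) (by linarith)
  · refine (continuousOn_convergenceRadius_evalSeries P 2 hdeg).comp (by fun_prop) ?_
    intro a ha
    have ha : -1 < a := ha
    exact Set.mem_Ioi.2 (by linarith)

/-! ### The general lower bound on the radius -/

/-- Adding a step acts linearly on these three sums. With `s = √(2 + 2 * a)`, the vector `(s, s, 2)`
is an eigenvector for `2 + s`, because `s * (2 + s) = 2 * s + 2 + 2 * a`; it dominates the initial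
values `(1, 1, 1)`. -/
theorem wordSum_pow_cornerCount_cons_le {a : ℝ} (ha : 0 ≤ a) (m : ℕ) :
    (wordSum m fun w => a ^ cornerCount (.E :: w)) ≤
        √(2 + 2 * a) * (2 + √(2 + 2 * a)) ^ m ∧
      (wordSum m fun w => a ^ cornerCount (.N :: w)) ≤
        √(2 + 2 * a) * (2 + √(2 + 2 * a)) ^ m ∧
      (wordSum m fun w => a ^ cornerCount w) ≤ 2 * (2 + √(2 + 2 * a)) ^ m := by
  have hs : √(2 + 2 * a) ^ 2 = 2 + 2 * a := Real.sq_sqrt (by linarith)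
  have hs1 : 1 ≤ √(2 + 2 * a) := Real.one_le_sqrt.2 (by linarith)
  set s := √(2 + 2 * a)
  induction m with
  | zero => simp [wordSum_zero, cornerCount_singleton, cornerCount_nil, hs1]
  | succ m ih =>
    obtain ⟨hE, hN, h0⟩ := ih
    have h1 := mul_le_mul_of_nonneg_left h0 ha
    have hL : s * (2 + s) = 2 * s + 2 + 2 * a := by nlinarith
    have hp : s * (2 + s) ^ (m + 1) =
        s * (2 + s) ^ m + s * (2 + s) ^ m + 2 * (2 + s) ^ m + a * (2 * (2 + s) ^ m) := by
      rw [pow_succ, mul_comm _ (2 + s), ← mul_assoc, hL]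
      ring
    simp only [wordSum_succ, sum_latticeStep, cornerCount_cons_cons, cornerCount_cons_W,
      cornerCount_cons_S, reduceCtorEq, and_true, and_false, or_self, or_true, or_false, if_true,
      if_false, add_zero, pow_succ, wordSum_mul_left, mul_comm _ a, and_self]
    refine ⟨?_, ?_, ?_⟩
    · rw [← pow_succ, hp]; linarith
    · rw [← pow_succ, hp]; linarith
    · rw [← pow_succ, pow_succ]; linarith

theorem ofReal_le_rhoQ {a : ℝ} (ha : 0 ≤ a) :
    ENNReal.ofReal (1 / (2 + √(2 + 2 * a)) ^ 2) ≤ rhoQ a := by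
  refine le_convergenceRadius_of_bound (by positivity) (C := 2) fun n => ?_
  have h1 := one_le_coeff_seriesQAt ha n
  rw [abs_of_nonneg (by linarith), coeff_seriesQAt, one_div, inv_pow, ← pow_mul,
    ← div_eq_mul_inv, div_le_iff₀ (by positivity)]
  refine le_trans (wordSum_mono _ _ _ fun w => ?_) (wordSum_pow_cornerCount_cons_le ha _).2.2
  split_ifs
  · exact le_rfl
  · positivity

theorem rhoQ_ne_top {a : ℝ} (ha : 0 ≤ a) : rhoQ a ≠ ⊤ := by
  refine ne_top_of_le_ne_top (ENNReal.ofReal_ne_top (r := 1 / 1))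
    (convergenceRadius_le_of_pow_le (c := 1) (k := 0) one_pos fun n => ?_)
  have := one_le_coeff_seriesQAt ha n
  rw [abs_of_nonneg (by linarith)]
  simpa using this

/-! ### Estimates for Catalan numbers -/

theorem centralBinom_sq_mul_le (n : ℕ) : n.centralBinom ^ 2 * (2 * n + 1) ≤ 16 ^ n := by
  induction n with
  | zero => simp
  | succ n ih =>
    have h := Nat.succ_mul_centralBinom_succ n
    refine le_of_mul_le_mul_left (a := (n + 1) ^ 2) ?_ (by positivity)
    calc (n + 1) ^ 2 * ((n + 1).centralBinom ^ 2 * (2 * (n + 1) + 1))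
        = ((n + 1) * (n + 1).centralBinom) ^ 2 * (2 * (n + 1) + 1) := by ring
      _ = n.centralBinom ^ 2 * (2 * n + 1) * (4 * (2 * n + 1) * (2 * n + 3)) := by rw [h]; ring
      _ ≤ 16 ^ n * (16 * (n + 1) ^ 2) := Nat.mul_le_mul ih (by nlinarith)
      _ = _ := by ring

theorem catalan_sq_mul_le (n : ℕ) : (catalan n : ℝ) ^ 2 * (n + 1) ^ 3 ≤ 16 ^ n := by
  have h1 := centralBinom_sq_mul_le n
  rw [← succ_mul_catalan_eq_centralBinom] at h1
  have h2 : catalan n ^ 2 * (n + 1) ^ 3 ≤ 16 ^ n := by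
    refine le_trans ?_ h1
    calc catalan n ^ 2 * (n + 1) ^ 3 = ((n + 1) * catalan n) ^ 2 * (n + 1) := by ring
      _ ≤ _ := Nat.mul_le_mul_left _ (by omega)
  exact_mod_cast h2

/-- Each Catalan number is at most `4 ^ i / (i + 1) ^ (3/2)`. The spare half powers become `1 / √(n
+ 1)` through `n + 1 ≤ (i + 1) * (j + 1)`, leaving a factor suited to binomial absorption. -/
theorem catalan_mul_catalan_le {i j n : ℕ} (h : i + j = n) :
    (catalan i * catalan j : ℝ) ≤ 4 ^ n / √(n + 1) * (1 / ((i + 1) * (j + 1))) := by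
  have hi := catalan_sq_mul_le i
  have hj := catalan_sq_mul_le j
  have hn : (0 : ℝ) < √((n : ℝ) + 1) := Real.sqrt_pos.2 (by positivity)
  have hsq : √((n : ℝ) + 1) ^ 2 = n + 1 := Real.sq_sqrt (by positivity)
  rw [div_mul_div_comm, mul_one, le_div_iff₀ (by positivity),
    ← pow_le_pow_iff_left₀ (by positivity) (by positivity) two_ne_zero]
  have hle : ((n : ℝ) + 1) ≤ (i + 1) * (j + 1) := by
    rw [← h]
    push_cast
    have : (0 : ℝ) ≤ i * j := by positivity
    nlinarith
  calc ((catalan i * catalan j : ℝ) * (√((n : ℝ) + 1) * ((i + 1) * (j + 1)))) ^ 2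
      = (catalan i * catalan j : ℝ) ^ 2 * (((i + 1) * (j + 1)) ^ 2 * √((n : ℝ) + 1) ^ 2) := by ring
    _ ≤ (catalan i * catalan j : ℝ) ^ 2 * (((i + 1) * (j + 1)) ^ 2 * ((i + 1) * (j + 1))) := by
        rw [hsq]; gcongr
    _ = ((catalan i : ℝ) ^ 2 * (i + 1) ^ 3) * ((catalan j : ℝ) ^ 2 * (j + 1) ^ 3) := by ring
    _ ≤ 16 ^ i * 16 ^ j := by gcongr
    _ = (4 ^ n) ^ 2 := by rw [← pow_add, h, ← pow_mul, mul_comm, pow_mul]; norm_num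

theorem four_pow_le_catalan (n : ℕ) : (4 : ℝ) ^ n ≤ 2 * (n + 1) ^ 2 * catalan n := by
  have h : 4 ^ n ≤ 2 * (n + 1) ^ 2 * catalan n := by
    rcases Nat.eq_zero_or_pos n with rfl | hn
    · simp
    · refine (Nat.four_pow_le_two_mul_self_mul_centralBinom n hn).trans ?_
      rw [← succ_mul_catalan_eq_centralBinom]
      calc 2 * n * ((n + 1) * catalan n) ≤ 2 * (n + 1) * ((n + 1) * catalan n) := by
            gcongr; omega
        _ = _ := by ring
  exact_mod_cast h

theorem four_pow_le_catalan_mul_catalan {i j n : ℕ} (h : i + j = n) :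
    (4 : ℝ) ^ n ≤ 4 * (n + 1) ^ 4 * (catalan i * catalan j) := by
  have hi : (i : ℝ) ≤ n := by exact_mod_cast (by omega : i ≤ n)
  have hj : (j : ℝ) ≤ n := by exact_mod_cast (by omega : j ≤ n)
  calc (4 : ℝ) ^ n = 4 ^ i * 4 ^ j := by rw [← pow_add, h]
    _ ≤ (2 * (i + 1) ^ 2 * catalan i) * (2 * (j + 1) ^ 2 * catalan j) := by
        gcongr <;> exact four_pow_le_catalan _
    _ ≤ (2 * (n + 1) ^ 2 * catalan i) * (2 * (n + 1) ^ 2 * catalan j) := by gcongr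
    _ = _ := by ring

/-! ### Binomial sums -/

theorem choose_mul_eq (k l : ℕ) :
    (k + l).choose k * ((k + l + 1) * (k + l + 2)) =
      (k + l + 2).choose (k + 1) * ((k + 1) * (l + 1)) := by
  have h1 := Nat.add_one_mul_choose_eq (k + l) k
  have h2 := Nat.add_one_mul_choose_eq (k + l + 1) l
  rw [Nat.choose_symm_of_eq_add (show k + l + 1 = l + (k + 1) by ring),
    Nat.choose_symm_of_eq_add (show k + l + 1 + 1 = (l + 1) + (k + 1) by ring)] at h2
  calc (k + l).choose k * ((k + l + 1) * (k + l + 2))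
      = ((k + l + 1) * (k + l).choose k) * (k + l + 2) := by ring
    _ = ((k + l + 1 + 1) * (k + l + 1).choose (k + 1)) * (k + 1) := by rw [h1]; ring
    _ = _ := by rw [h2]; ring

theorem choose_mul_one_div_eq (k l : ℕ) :
    ((k + l).choose k : ℝ) * (1 / ((k + 1) * (l + 1))) =
      (k + l + 2).choose (k + 1) / ((k + l + 1) * (k + l + 2)) := by
  have h : ((k + l).choose k : ℝ) * ((k + l + 1) * (k + l + 2)) =
      (k + l + 2).choose (k + 1) * ((k + 1) * (l + 1)) := by exact_mod_cast choose_mul_eq k l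
  rw [mul_one_div, div_eq_div_iff (by positivity) (by positivity), h]

theorem sum_range_odd_le (f : ℕ → ℝ) (hf : ∀ k, 0 ≤ f k) (n : ℕ) :
    ∑ i ∈ Finset.range n, f (2 * i + 1) ≤ ∑ k ∈ Finset.range (2 * n), f k := by
  induction n with
  | zero => simp
  | succ n ih =>
    rw [Finset.sum_range_succ, mul_add, mul_one, Finset.sum_range_succ, Finset.sum_range_succ]
    linarith [hf (2 * n)]

/-- The weight `1 + (-1) ^ k` selects even `k` twice; the alternating sum is `0` or `1`, so it can
be dropped. -/
theorem four_pow_le_sum_choose_even (n : ℕ) :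
    (4 : ℝ) ^ n ≤ 2 * ∑ i ∈ Finset.range (n + 1), ((2 * n).choose (2 * i) : ℝ) := by
  have hsplit : ∀ (f : ℕ → ℝ) (m : ℕ), ∑ k ∈ Finset.range (2 * m + 1), (1 + (-1) ^ k) * f k =
      2 * ∑ i ∈ Finset.range (m + 1), f (2 * i) := by
    intro f m
    induction m with
    | zero => norm_num
    | succ m ih =>
      rw [Finset.sum_range_succ _ (m + 1), mul_add 2 (∑ _ ∈ _, _), ← ih,
        show 2 * (m + 1) + 1 = 2 * m + 1 + 1 + 1 by ring, Finset.sum_range_succ,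
        Finset.sum_range_succ]
      simp only [mul_add, mul_one, pow_add, pow_mul]
      norm_num
  rw [← hsplit fun k => ((2 * n).choose k : ℝ)]
  simp only [add_mul, one_mul, Finset.sum_add_distrib]
  have h1 : ∑ k ∈ Finset.range (2 * n + 1), ((2 * n).choose k : ℝ) = 4 ^ n := by
    have := Nat.sum_range_choose (2 * n)
    rw [pow_mul] at this
    exact_mod_cast this
  have h2 : 0 ≤ ∑ k ∈ Finset.range (2 * n + 1), (-1 : ℝ) ^ k * ((2 * n).choose k : ℝ) := by
    have := Int.alternating_sum_range_choose (n := 2 * n)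
    have h3 : (0 : ℤ) ≤ ∑ k ∈ Finset.range (2 * n + 1), (-1) ^ k * ((2 * n).choose k : ℤ) := by
      rw [this]; split_ifs <;> simp
    exact_mod_cast h3
  linarith

/-! ### The cases `a = ±1` -/

theorem sum_mul_catalan_le {n : ℕ} {c : ℕ × ℕ → ℝ} (hc : ∀ ij, 0 ≤ c ij) {B : ℝ}
    (hB : ∑ ij ∈ Finset.HasAntidiagonal.antidiagonal n, c ij * (1 / ((ij.1 + 1) * (ij.2 + 1))) ≤ B) :
    ∑ ij ∈ Finset.HasAntidiagonal.antidiagonal n, c ij * (catalan ij.1 * catalan ij.2) ≤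
      4 ^ n / √(n + 1) * B := by
  refine le_trans (Finset.sum_le_sum fun ij hij => mul_le_mul_of_nonneg_left
    (catalan_mul_catalan_le (Finset.HasAntidiagonal.mem_antidiagonal.1 hij)) (hc ij)) ?_
  simp only [mul_left_comm (c _)]
  rw [← Finset.mul_sum]
  gcongr

theorem le_sum_mul_catalan {n : ℕ} {c : ℕ × ℕ → ℝ} (hc : ∀ ij, 0 ≤ c ij) :
    4 ^ n * ∑ ij ∈ Finset.HasAntidiagonal.antidiagonal n, c ij ≤ 4 * ((n : ℝ) + 1) ^ 4 *
      ∑ ij ∈ Finset.HasAntidiagonal.antidiagonal n, c ij * (catalan ij.1 * catalan ij.2) := by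
  rw [Finset.mul_sum, Finset.mul_sum]
  refine Finset.sum_le_sum fun ij hij => ?_
  have := mul_le_mul_of_nonneg_left
    (four_pow_le_catalan_mul_catalan (Finset.HasAntidiagonal.mem_antidiagonal.1 hij)) (hc ij)
  linarith

theorem sum_antidiagonal_eq_sum_range (n : ℕ) (f : ℕ → ℝ) :
    ∑ ij ∈ Finset.HasAntidiagonal.antidiagonal n, f ij.1 = ∑ i ∈ Finset.range (n + 1), f i :=
  Finset.Nat.sum_antidiagonal_eq_sum_range_succ_mk (fun ij : ℕ × ℕ => f ij.1) n

theorem coeff_seriesQAt_neg_one_le (n : ℕ) : PowerSeries.coeff n (seriesQAt (-1)) ≤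
    4 * 8 ^ n / (((n : ℝ) + 1) ^ 2 * √(n + 1)) := by
  rw [coeff_seriesQAt_neg_one]
  have hB : ∑ ij ∈ Finset.HasAntidiagonal.antidiagonal n,
      (n.choose ij.1 : ℝ) * (1 / ((ij.1 + 1) * (ij.2 + 1))) ≤ 4 * 2 ^ n / ((n : ℝ) + 1) ^ 2 := by
    have h1 : ∀ ij ∈ Finset.HasAntidiagonal.antidiagonal n,
        (n.choose ij.1 : ℝ) * (1 / ((ij.1 + 1) * (ij.2 + 1))) =
          (n + 2).choose (ij.1 + 1) / (((n : ℝ) + 1) * (n + 2)) := by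
      intro ij hij
      rw [← Finset.HasAntidiagonal.mem_antidiagonal.1 hij, choose_mul_one_div_eq]
      push_cast
      rfl
    rw [Finset.sum_congr rfl h1, ← Finset.sum_div,
      sum_antidiagonal_eq_sum_range n fun i => ((n + 2).choose (i + 1) : ℝ)]
    -- This is row `n + 2` of Pascal's triangle without its two end terms.
    have h2 : ∑ i ∈ Finset.range (n + 1), ((n + 2).choose (i + 1) : ℝ) ≤ 4 * 2 ^ n := by
      have h3 := Nat.sum_range_choose (n + 2)
      rw [Finset.sum_range_succ, Finset.sum_range_succ'] at h3
      have h4 : ∑ i ∈ Finset.range (n + 1), (n + 2).choose (i + 1) ≤ 4 * 2 ^ n := by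
        rw [pow_add] at h3
        omega
      exact_mod_cast h4
    rw [pow_two]
    gcongr
    linarith
  refine (sum_mul_catalan_le (c := fun ij => (n.choose ij.1 : ℝ)) (fun _ => by positivity)
    hB).trans (le_of_eq ?_)
  rw [show (8 : ℝ) = 4 * 2 by norm_num, mul_pow]
  field_simp

theorem coeff_seriesQAt_one_le (n : ℕ) : PowerSeries.coeff n (seriesQAt 1) ≤
    16 * 16 ^ n / (((n : ℝ) + 1) ^ 2 * √(n + 1)) := by
  rw [coeff_seriesQAt_one]
  have hB : ∑ ij ∈ Finset.HasAntidiagonal.antidiagonal n,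
      ((2 * n).choose (2 * ij.1) : ℝ) * (1 / ((ij.1 + 1) * (ij.2 + 1))) ≤
        16 * 4 ^ n / ((n : ℝ) + 1) ^ 2 := by
    -- Absorption at `2 * i`, `2 * j` produces `(2 * i + 1) * (2 * j + 1)`, which is at most `4 * (i
    -- + 1) * (j + 1)`.
    have h1 : ∀ ij ∈ Finset.HasAntidiagonal.antidiagonal n,
        ((2 * n).choose (2 * ij.1) : ℝ) * (1 / ((ij.1 + 1) * (ij.2 + 1))) ≤
          4 * ((2 * n + 2).choose (2 * ij.1 + 1) / ((2 * (n : ℝ) + 1) * (2 * n + 2))) := by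
      intro ij hij
      have h := choose_mul_one_div_eq (2 * ij.1) (2 * ij.2)
      rw [← mul_add, Finset.HasAntidiagonal.mem_antidiagonal.1 hij] at h
      have hn : (n : ℝ) = ij.1 + ij.2 := by
        exact_mod_cast (Finset.HasAntidiagonal.mem_antidiagonal.1 hij).symm
      have h' : ((2 * n + 2).choose (2 * ij.1 + 1) : ℝ) / ((2 * (n : ℝ) + 1) * (2 * n + 2)) =
          ((2 * n).choose (2 * ij.1) : ℝ) * (1 / ((2 * ij.1 + 1) * (2 * ij.2 + 1))) := by
        push_cast at h
        rw [h, hn]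
        ring_nf
      rw [h', mul_left_comm]
      gcongr
      rw [mul_one_div, div_le_div_iff₀ (by positivity) (by positivity)]
      have hi : (0 : ℝ) ≤ ij.1 := by positivity
      have hj : (0 : ℝ) ≤ ij.2 := by positivity
      nlinarith
    refine (Finset.sum_le_sum h1).trans ?_
    rw [← Finset.mul_sum, ← Finset.sum_div,
      sum_antidiagonal_eq_sum_range n fun i => ((2 * n + 2).choose (2 * i + 1) : ℝ)]
    have h2 : ∑ i ∈ Finset.range (n + 1), ((2 * n + 2).choose (2 * i + 1) : ℝ) ≤ 4 * 4 ^ n := by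
      refine (sum_range_odd_le (fun k => ((2 * n + 2).choose k : ℝ))
        (fun _ => by positivity) (n + 1)).trans ?_
      have h3 := Nat.sum_range_choose (2 * n + 2)
      rw [Finset.sum_range_succ, pow_add, pow_mul] at h3
      have h4 : ∑ k ∈ Finset.range (2 * (n + 1)), (2 * n + 2).choose k ≤ 4 * 4 ^ n := by
        rw [show 2 * (n + 1) = 2 * n + 2 by ring]
        norm_num at h3
        omega
      exact_mod_cast h4
    rw [mul_div_assoc', pow_two]
    gcongr ?_ / (?_ * ?_) <;> linarith
  refine (sum_mul_catalan_le (c := fun ij => ((2 * n).choose (2 * ij.1) : ℝ))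
    (fun _ => by positivity) hB).trans (le_of_eq ?_)
  rw [show (16 : ℝ) ^ n = 4 ^ n * 4 ^ n by rw [← mul_pow]; norm_num]
  field_simp

theorem pow_le_coeff_seriesQAt_neg_one (n : ℕ) :
    (8 : ℝ) ^ n ≤ 4 * ((n : ℝ) + 1) ^ 4 * PowerSeries.coeff n (seriesQAt (-1)) := by
  rw [coeff_seriesQAt_neg_one]
  refine le_trans (le_of_eq ?_)
    (le_sum_mul_catalan (c := fun ij => (n.choose ij.1 : ℝ)) fun _ => by positivity)
  rw [sum_antidiagonal_eq_sum_range n fun i => (n.choose i : ℝ)]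
  have h : ∑ i ∈ Finset.range (n + 1), (n.choose i : ℝ) = 2 ^ n := by
    exact_mod_cast Nat.sum_range_choose n
  rw [h, ← mul_pow]
  norm_num

theorem pow_le_coeff_seriesQAt_one (n : ℕ) :
    (16 : ℝ) ^ n ≤ 8 * ((n : ℝ) + 1) ^ 4 * PowerSeries.coeff n (seriesQAt 1) := by
  rw [coeff_seriesQAt_one]
  have h1 := le_sum_mul_catalan (n := n) (c := fun ij => ((2 * n).choose (2 * ij.1) : ℝ))
    fun _ => by positivity
  rw [sum_antidiagonal_eq_sum_range n fun i => ((2 * n).choose (2 * i) : ℝ)] at h1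
  have h2 := mul_le_mul_of_nonneg_left (four_pow_le_sum_choose_even n)
    (by positivity : (0 : ℝ) ≤ 4 ^ n)
  have h3 : (16 : ℝ) ^ n = 4 ^ n * 4 ^ n := by rw [← mul_pow]; norm_num
  linarith

/-- Two-sided bounds on the coefficients determine the radius of convergence, and make the
derivative converge there. -/
theorem convergenceRadius_eq_and_convergesAt_derivative {F : PowerSeries ℝ} {K c d : ℝ} {k : ℕ}
    (hK : 0 < K) (hF : ∀ n, 0 ≤ PowerSeries.coeff n F)
    (hle : ∀ n : ℕ, PowerSeries.coeff n F ≤ c * K ^ n / (((n : ℝ) + 1) ^ 2 * √(n + 1)))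
    (hge : ∀ n : ℕ, K ^ n ≤ d * ((n : ℝ) + 1) ^ k * PowerSeries.coeff n F) :
    convergenceRadius F = ENNReal.ofReal (1 / K) ∧
      ConvergesAt (PowerSeries.derivative ℝ F) (1 / K) := by
  have hc : 0 ≤ c := by simpa using (hF 0).trans (hle 0)
  refine ⟨le_antisymm ?_ ?_, ?_⟩
  · exact convergenceRadius_le_of_pow_le hK fun n => by rw [abs_of_nonneg (hF n)]; exact hge n
  · refine le_convergenceRadius_of_bound (by positivity) (C := c) fun n => ?_
    rw [abs_of_nonneg (hF n), one_div, inv_pow, ← div_eq_mul_inv, div_le_iff₀ (by positivity)]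
    refine (hle n).trans (div_le_self (by positivity) ?_)
    have h1 : (1 : ℝ) ≤ n + 1 := by linarith [(Nat.cast_nonneg n : (0 : ℝ) ≤ n)]
    exact one_le_mul_of_one_le_of_one_le (one_le_pow₀ h1) (Real.one_le_sqrt.2 h1)
  · have hsum := ((Real.summable_one_div_nat_add_rpow 1 (3 / 2)).2 (by norm_num)).mul_left (c * K)
    refine Summable.of_nonneg_of_le (fun n => ?_) (fun n => ?_) hsum
    · rw [PowerSeries.coeff_derivative]
      have := hF (n + 1)
      positivity
    · rw [PowerSeries.coeff_derivative]
      have hn : (0 : ℝ) < (n : ℝ) + 1 := by positivity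
      have hs : (0 : ℝ) < √((n : ℝ) + 1) := Real.sqrt_pos.2 hn
      have hrpow : |(n : ℝ) + 1| ^ (3 / 2 : ℝ) = ((n : ℝ) + 1) * √((n : ℝ) + 1) := by
        rw [abs_of_pos hn, Real.sqrt_eq_rpow, show (3 / 2 : ℝ) = 1 + 1 / 2 by norm_num,
          Real.rpow_add hn, Real.rpow_one]
      rw [hrpow]
      have h1 := hle (n + 1)
      push_cast at h1
      calc PowerSeries.coeff (n + 1) F * ((n : ℝ) + 1) * (1 / K) ^ n
          ≤ c * K ^ (n + 1) / (((n : ℝ) + 1 + 1) ^ 2 * √((n : ℝ) + 1 + 1)) * ((n : ℝ) + 1) *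
            (1 / K) ^ n := by gcongr
        _ ≤ c * K ^ (n + 1) / (((n : ℝ) + 1) ^ 2 * √((n : ℝ) + 1)) * ((n : ℝ) + 1) *
            (1 / K) ^ n := by gcongr <;> linarith
        _ = c * K * (1 / (((n : ℝ) + 1) * √((n : ℝ) + 1))) := by
            rw [one_div, inv_pow, pow_succ]
            field_simp

theorem coeff_seriesQAt_neg_one_nonneg (n : ℕ) : 0 ≤ PowerSeries.coeff n (seriesQAt (-1)) := by
  rw [coeff_seriesQAt_neg_one]
  positivity

theorem mainTheorem11 :
    rhoQ (-1) = 1 / 8 ∧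
    rhoQ 1 = 1 / 16 ∧
    (∀ a : ℝ, 0 ≤ a → rhoQ a ≠ ⊤) ∧
    AntitoneOn rhoQ (Set.Ici 0) ∧
    ContinuousOn rhoQ (Set.Ioi 0) ∧
    (∀ a : ℝ, 0 ≤ a → ENNReal.ofReal (1 / (2 + Real.sqrt (2 + 2 * a)) ^ 2) ≤ rhoQ a) ∧
    ConvergesAt (PowerSeries.derivative ℝ (seriesQAt (-1))) (rhoQ (-1)).toReal ∧
    ConvergesAt (PowerSeries.derivative ℝ (seriesQAt 1)) (rhoQ 1).toReal ∧
    (IsAddOnePositive seriesQ →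
      AntitoneOn rhoQ (Set.Ici (-1)) ∧ ContinuousOn rhoQ (Set.Ioi (-1))) := by
  obtain ⟨h1, h2⟩ := convergenceRadius_eq_and_convergesAt_derivative (by norm_num)
    coeff_seriesQAt_neg_one_nonneg coeff_seriesQAt_neg_one_le pow_le_coeff_seriesQAt_neg_one
  obtain ⟨h3, h4⟩ := convergenceRadius_eq_and_convergesAt_derivative (by norm_num)
    (fun n => zero_le_one.trans (one_le_coeff_seriesQAt zero_le_one n))
    coeff_seriesQAt_one_le pow_le_coeff_seriesQAt_one
  have hrho : rhoQ = fun a => convergenceRadius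
      (evalSeries (fun n => PowerSeries.coeff n seriesQ) a) := by
    funext a
    rw [rhoQ, seriesQAt_eq_evalSeries]
  change rhoQ (-1) = _ at h1
  change rhoQ 1 = _ at h3
  refine ⟨?_, ?_, fun a ha => rhoQ_ne_top ha, ?_, ?_, fun a ha => ofReal_le_rhoQ ha, ?_, ?_,
    antitoneOn_and_continuousOn_rhoQ_of_isAddOnePositive⟩
  · rw [h1, ENNReal.ofReal_div_of_pos (by norm_num)]
    simp
  · rw [h3, ENNReal.ofReal_div_of_pos (by norm_num)]
    simp
  · rw [hrho]
    exact antitoneOn_convergenceRadius_evalSeries _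
  · rw [hrho]
    exact continuousOn_convergenceRadius_evalSeries _ 2 natDegree_coeff_seriesQ_le
  · rwa [h1, ENNReal.toReal_ofReal (by norm_num)]
  · rwa [h3, ENNReal.toReal_ofReal (by norm_num)]
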